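/- Let $k$ be an algebraically closed field of characteristic zero, let $m\ge 1$, let $q\in k^{\times}$ with $q\neq 1$, and suppose that the (multiplicative) order of $q$ is at least $m$, where infinite order is allowed. Let $R=k\langle u,v\rangle/(vu-quv-1)$, let $C_m=\langle\tau\rangle$ be a cyclic group of order $m$, and let the group Hopf algebra $kC_m$ coact on $R$ from the right by the algebra map $\rho:R\to R\otimes kC_m$ with $\rho(u)=u\otimes\tau$ and $\rho(v)=v\otimes\tau^{-1}$. Put $R_g=\{f\in R:\rho(f)=f\otimes g\}$ for $g\in C_m$ and $B=R^{co\,C_m}=R_1=\{f\in R:\rho(f)=f\otimes 1\}$. Then: 1. $R$ is strongly $C_m$-graded by the subspaces $R_g$: $R=\bigoplus_{g\in C_m}R_g$ and $R_gR_h=R_{gh}$ for all $g,h\in C_m$; 2. $B\subset R$ is a right $kC_m$-Galois extension: the map $\beta:R\otimes_B R\to R\otimes kC_m$, $\beta(a\otimes b)=(a\otimes 1)\rho(b)$, is surjective; 3. $B$ has (left and right) global dimension $2$. -/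

import Mathlib

open scoped TensorProduct

noncomputable section

/-! ### The quantum Weyl algebra -/

/-- The relation `v u = q u v + 1` on the free algebra on two letters `u = ι 0` and `v = ι 1`. -/
inductive QWeylRel (k : Type*) [Field k] (q : k) :
    FreeAlgebra k (Fin 2) → FreeAlgebra k (Fin 2) → Prop
  | rel : QWeylRel k q
      (FreeAlgebra.ι k 1 * FreeAlgebra.ι k 0)
      (q • (FreeAlgebra.ι k 0 * FreeAlgebra.ι k 1) + 1)

/-- The algebra `k⟨u, v⟩ / (v u - q u v - 1)`. -/
abbrev QWeyl (k : Type*) [Field k] (q : k) : Type _ := RingQuot (QWeylRel k q)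

namespace QWeyl

variable (k : Type*) [Field k] (q : k)

/-- The generator `u`. -/
def u : QWeyl k q := RingQuot.mkAlgHom k (QWeylRel k q) (FreeAlgebra.ι k 0)

/-- The generator `v`. -/
def v : QWeyl k q := RingQuot.mkAlgHom k (QWeylRel k q) (FreeAlgebra.ι k 1)

theorem v_mul_u : v k q * u k q = q • (u k q * v k q) + 1 := by
  have h := RingQuot.mkAlgHom_rel k (QWeylRel.rel (k := k) (q := q))
  rw [map_mul, map_add, map_smul, map_mul, map_one] at h
  exact h

end QWeyl

/-! ### Comodule algebras, coinvariants and Galois extensions -/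

/-- A right `K`-comodule algebra structure on `A`: an algebra map `ρ : A → A ⊗ K` which is
coassociative and counital. -/
structure RightComoduleAlgebra (k K A : Type*) [Field k] [Ring K] [Bialgebra k K]
    [Ring A] [Algebra k A] where
  /-- the coaction -/
  ρ : A →ₐ[k] A ⊗[k] K
  coassoc : ∀ a, TensorProduct.assoc k A K K (ρ.toLinearMap.rTensor K (ρ a)) =
    (Coalgebra.comul (R := k) (A := K)).lTensor A (ρ a)
  counital : ∀ a, TensorProduct.rid k A ((Coalgebra.counit (R := k) (A := K)).lTensor A (ρ a)) = a

namespace RightComoduleAlgebra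

variable {k K A : Type*} [Field k] [Ring K] [Bialgebra k K] [Ring A] [Algebra k A]
  (C : RightComoduleAlgebra k K A)

/-- The coinvariant subalgebra `A^{co K} = {a | ρ a = a ⊗ 1}`. -/
def coinvariants : Subalgebra k A :=
  AlgHom.equalizer C.ρ Algebra.TensorProduct.includeLeft

/-- The elements `f` with `ρ f = f ⊗ g`, for a fixed `g` in `K`. -/
def component (g : K) : Submodule k A :=
  LinearMap.eqLocus C.ρ.toLinearMap ((TensorProduct.mk k A K).flip g)

theorem mem_coinvariants (a : A) : a ∈ C.coinvariants ↔ C.ρ a = a ⊗ₜ[k] (1 : K) := Iff.rfl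

theorem mem_component (g : K) (a : A) : a ∈ C.component g ↔ C.ρ a = a ⊗ₜ[k] g := Iff.rfl

end RightComoduleAlgebra

/-- The relations `a b ⊗ a' = a ⊗ b a'` with `b` in `B`, in `A ⊗ A` over the base field. -/
def balancedRelations {k A : Type*} [Field k] [Ring A] [Algebra k A] (B : Subalgebra k A) :
    Submodule k (A ⊗[k] A) :=
  Submodule.span k {x | ∃ a a' : A, ∃ b ∈ B, x = (a * b) ⊗ₜ[k] a' - a ⊗ₜ[k] (b * a')}

/-- The tensor product `A ⊗_B A` over a (not necessarily commutative) subalgebra `B`. -/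
abbrev BalancedTensor {k A : Type*} [Field k] [Ring A] [Algebra k A] (B : Subalgebra k A) :
    Type _ := (A ⊗[k] A) ⧸ balancedRelations B

namespace RightComoduleAlgebra

variable {k K A : Type*} [Field k] [Ring K] [Bialgebra k K] [Ring A] [Algebra k A]
  (C : RightComoduleAlgebra k K A)

/-- The map `A ⊗ A → A ⊗ K`, `a ⊗ b ↦ (a ⊗ 1) ρ(b)`, over the base field. -/
def preGaloisMap : A ⊗[k] A →ₗ[k] A ⊗[k] K :=
  TensorProduct.lift <| (LinearMap.mul k (A ⊗[k] K)).compl₁₂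
    (Algebra.TensorProduct.includeLeft (R := k) (S := k) (A := A) (B := K)).toLinearMap
    C.ρ.toLinearMap

theorem preGaloisMap_tmul (a b : A) :
    C.preGaloisMap (a ⊗ₜ[k] b) = (a ⊗ₜ[k] (1 : K)) * C.ρ b := rfl

theorem balancedRelations_le : balancedRelations C.coinvariants ≤ LinearMap.ker C.preGaloisMap := by
  refine Submodule.span_le.2 ?_
  rintro _ ⟨a, a', b, hb, rfl⟩
  rw [mem_coinvariants] at hb
  simp [preGaloisMap_tmul, hb, ← mul_assoc]

/-- The Galois map `β : A ⊗_B A → A ⊗ K`, `β (a ⊗ b) = (a ⊗ 1) ρ(b)`, for `B = A^{co K}`. -/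
def galoisMap : BalancedTensor C.coinvariants →ₗ[k] A ⊗[k] K :=
  (balancedRelations C.coinvariants).liftQ C.preGaloisMap C.balancedRelations_le

/-- The extension `A^{co K} ⊂ A` is (right) `K`-Galois. -/
def IsGaloisExtension : Prop := Function.Surjective C.galoisMap

end RightComoduleAlgebra

/-! ### Strongly graded algebras -/

open Classical in
/-- `A` is the internal direct sum of the subspaces `𝒜 g`, with `1` in degree `1`, and
`𝒜 g * 𝒜 h = 𝒜 (g * h)` for all `g`, `h`, where the left side is the span of the products. -/
def IsStronglyGraded {k A G : Type*} [Field k] [Ring A] [Algebra k A] [Group G]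
    (𝒜 : G → Submodule k A) : Prop :=
  DirectSum.IsInternal 𝒜 ∧ (1 : A) ∈ 𝒜 1 ∧ ∀ g h : G, 𝒜 g * 𝒜 h = 𝒜 (g * h)

/-! ### Global dimension -/

/-- The (left) global dimension of a ring: the supremum of the projective dimensions of its left
modules. The right global dimension is that of the opposite ring. -/
def globalDimension.{w} (S : Type w) [Ring S] : WithBot ℕ∞ :=
  ⨆ M : ModuleCat.{w} S, CategoryTheory.projectiveDimension M

/-! ### The coaction of a group algebra on the quantum Weyl algebra -/

namespace QWeyl

variable (k : Type*) [Field k] (q : k) {G : Type*} [Group G] (τ : G)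

/-- The algebra map `R → R ⊗ kG` with `u ↦ u ⊗ τ` and `v ↦ v ⊗ τ⁻¹`. -/
def coactionHom : QWeyl k q →ₐ[k] QWeyl k q ⊗[k] MonoidAlgebra k G :=
  RingQuot.liftAlgHom k ⟨FreeAlgebra.lift k
    ![u k q ⊗ₜ[k] MonoidAlgebra.of k G τ, v k q ⊗ₜ[k] MonoidAlgebra.of k G τ⁻¹], by
    rintro _ _ ⟨⟩
    have h1 : MonoidAlgebra.of k G τ⁻¹ * MonoidAlgebra.of k G τ = 1 := by
      rw [← map_mul, inv_mul_cancel, map_one]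
    have h2 : MonoidAlgebra.of k G τ * MonoidAlgebra.of k G τ⁻¹ = 1 := by
      rw [← map_mul, mul_inv_cancel, map_one]
    simp only [map_mul, map_add, map_smul, map_one, FreeAlgebra.lift_ι_apply,
      Matrix.cons_val_zero, Matrix.cons_val_one, Algebra.TensorProduct.tmul_mul_tmul, h1, h2,
      v_mul_u, TensorProduct.add_tmul, TensorProduct.smul_tmul', Algebra.TensorProduct.one_def]⟩

theorem coactionHom_u : coactionHom k q τ (u k q) = u k q ⊗ₜ[k] MonoidAlgebra.of k G τ := by
  simp [coactionHom, u]

theorem coactionHom_v : coactionHom k q τ (v k q) = v k q ⊗ₜ[k] MonoidAlgebra.of k G τ⁻¹ := by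
  simp [coactionHom, v]

theorem hom_ext {B : Type*} [Semiring B] [Algebra k B] {f g : QWeyl k q →ₐ[k] B}
    (hu : f (u k q) = g (u k q)) (hv : f (v k q) = g (v k q)) : f = g := by
  apply RingQuot.ringQuot_ext'
  apply FreeAlgebra.hom_ext
  funext i
  fin_cases i
  · exact hu
  · exact hv

/-- The right `kG`-comodule algebra structure on `k⟨u, v⟩ / (v u - q u v - 1)` with
`ρ(u) = u ⊗ τ` and `ρ(v) = v ⊗ τ⁻¹`. -/
def coaction : RightComoduleAlgebra k (MonoidAlgebra k G) (QWeyl k q) where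
  ρ := coactionHom k q τ
  coassoc := by
    have h : ((Algebra.TensorProduct.assoc k k k (QWeyl k q) (MonoidAlgebra k G)
        (MonoidAlgebra k G)).toAlgHom.comp (Algebra.TensorProduct.map (coactionHom k q τ)
          (AlgHom.id k (MonoidAlgebra k G)))).comp (coactionHom k q τ) =
        (Algebra.TensorProduct.map (AlgHom.id k (QWeyl k q))
          (Bialgebra.comulAlgHom k (MonoidAlgebra k G))).comp (coactionHom k q τ) := by
      apply hom_ext <;> simp [coactionHom_u, coactionHom_v]
    intro a
    exact DFunLike.congr_fun h a
  counital := by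
    have h : ((Algebra.TensorProduct.rid k k (QWeyl k q)).toAlgHom.comp
        (Algebra.TensorProduct.map (AlgHom.id k (QWeyl k q))
          (Bialgebra.counitAlgHom k (MonoidAlgebra k G)))).comp (coactionHom k q τ) =
        AlgHom.id k (QWeyl k q) := by
      apply hom_ext <;> simp [coactionHom_u, coactionHom_v]
    intro a
    exact DFunLike.congr_fun h a

end QWeyl

end

open scoped TensorProduct

noncomputable section

/-! ### Projective dimension and short resolutions -/

section Resolution

open CategoryTheory

universe w

variable {S : Type w} [Ring S] {P₂ P₁ P₀ M : Type w}
  [AddCommGroup P₂] [Module S P₂] [AddCommGroup P₁] [Module S P₁]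
  [AddCommGroup P₀] [Module S P₀] [AddCommGroup M] [Module S M]
  {f₂ : P₂ →ₗ[S] P₁} {f₁ : P₁ →ₗ[S] P₀} {f₀ : P₀ →ₗ[S] M}

/-! Strong grading amounts to `1 ∈ R_g R_{g⁻¹}` for every `g`, and it is enough to treat `g = τ` and
`g = τ⁻¹`. The ideal `R_τ R_{τ⁻¹}` of `B` contains `u v` and `v^(m-1) u^(m-1)`. Modulo `B u v`,
`v^(n+1) u^(n+1)` is `[n+1]_q v^n u^n`, where `[j]_q = 1 + q + ⋯ + q^(j-1)` is nonzero for `0 < j <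
m` by the bound on the order of `q`. Descent on the exponent therefore reaches `1`
(`one_mem_of_pow_mul_pow_mem`). Writing `1 = ∑ x y` with `x ∈ R_{g⁻¹}`, `y ∈ R_g` gives surjectivity
of the Galois map and a dual basis making `R` projective over `B`.

Upper bound: the basis `u^i v^j` makes the Koszul complex `0 → R ⊗ N → (R ⊗ N)² → R ⊗ N → N → 0`
exact for each left `R`-module `N`. Its terms are free over `R`, hence projective over `B`. A
`B`-module `M` is a direct summand of the `R`-module `Hom_B(R, M)`, thanks to the bimodule
projection `R → B`, so its projective dimension is at most 2.

Lower bound: if the one-dimensional module given by a suitable character `ω` had projective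
dimension at most 1 over `B`, the second Koszul differential would have a `B`-linear left inverse.
Composing this with a second character `χ` and evaluating at `∑_{i<m} u^i` gives `m = 0`, which is
absurd in characteristic zero (`not_hasProjectiveDimensionLT_two`).

Exchanging `u` and `v` is an anti-automorphism preserving `B`, so the right dimension equals the
left one. -/

theorem shortExact_ker_of_exact (hinj : Function.Injective f₂) (hex : Function.Exact f₂ f₁)
    (hex' : Function.Exact f₁ f₀) :
    ∃ T : ShortComplex (ModuleCat.{w} S), T.ShortExact ∧ T.X₁ = ModuleCat.of S P₂ ∧
      T.X₂ = ModuleCat.of S P₁ ∧ T.X₃ = ModuleCat.of S (LinearMap.ker f₀) := by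
  let g : P₁ →ₗ[S] LinearMap.ker f₀ := f₁.codRestrict _ fun x => hex'.apply_apply_eq_zero x
  refine ⟨ModuleCat.shortComplexOfCompEqZero f₂ g ?_,
    ModuleCat.shortComplex_shortExact _ ?_ hinj ?_, rfl, rfl, rfl⟩
  · ext x
    exact hex.apply_apply_eq_zero x
  · intro y
    refine Iff.trans ?_ (hex y)
    exact Subtype.ext_iff
  · rintro ⟨y, hy⟩
    obtain ⟨x, rfl⟩ := (hex' y).1 hy
    exact ⟨x, rfl⟩

theorem hasProjectiveDimensionLE_two_of_exact [Module.Projective S P₂] [Module.Projective S P₁]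
    [Module.Projective S P₀] (hinj : Function.Injective f₂) (hex : Function.Exact f₂ f₁)
    (hex' : Function.Exact f₁ f₀) (hsurj : Function.Surjective f₀) :
    HasProjectiveDimensionLE (ModuleCat.of S M) 2 := by
  have h2 : HasProjectiveDimensionLT (ModuleCat.of S P₂) 1 :=
    projective_iff_hasProjectiveDimensionLT_one.1 ((IsProjective.iff_projective P₂).1 ‹_›)
  have h1 : Projective (ModuleCat.of S P₁) := (IsProjective.iff_projective P₁).1 ‹_›
  have h0 : Projective (ModuleCat.of S P₀) := (IsProjective.iff_projective P₀).1 ‹_›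
  obtain ⟨T, hT, e1, e2, e3⟩ := shortExact_ker_of_exact hinj hex hex'
  have hK : HasProjectiveDimensionLT (ModuleCat.of S (LinearMap.ker f₀)) 2 := by
    rw [← e3]
    refine hT.hasProjectiveDimensionLT_X₃ 1 (by rw [e1]; exact h2) ?_
    rw [e2]
    infer_instance
  exact (LinearMap.shortExact_shortComplexKer hsurj).hasProjectiveDimensionLT_X₃ 2 hK
    (inferInstanceAs (HasProjectiveDimensionLT (ModuleCat.of S P₀) 3))

/-- Projective dimension at most 1 makes the first syzygy `ker f₀` projective, so `P₁ → ker f₀`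
splits, and with it the inclusion `f₂` of its kernel. -/
theorem exists_leftInverse_of_hasProjectiveDimensionLT_two [Module.Projective S P₀]
    (hinj : Function.Injective f₂) (hex : Function.Exact f₂ f₁)
    (hex' : Function.Exact f₁ f₀) (hsurj : Function.Surjective f₀)
    (h : HasProjectiveDimensionLT (ModuleCat.of S M) 2) :
    ∃ s : P₁ →ₗ[S] P₂, s ∘ₗ f₂ = LinearMap.id := by
  have h0 : Projective (ModuleCat.of S P₀) := (IsProjective.iff_projective P₀).1 ‹_›
  have hK : HasProjectiveDimensionLT (ModuleCat.of S (LinearMap.ker f₀)) 1 :=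
    (LinearMap.shortExact_shortComplexKer hsurj).hasProjectiveDimensionLT_X₁ 1
      (inferInstanceAs (HasProjectiveDimensionLT (ModuleCat.of S P₀) 1)) h
  have hP : Module.Projective S (LinearMap.ker f₀) :=
    (IsProjective.iff_projective _).2 (projective_iff_hasProjectiveDimensionLT_one.2 hK)
  let g : P₁ →ₗ[S] LinearMap.ker f₀ := f₁.codRestrict _ fun x => hex'.apply_apply_eq_zero x
  have hg : Function.Surjective g := by
    rintro ⟨y, hy⟩
    obtain ⟨x, rfl⟩ := (hex' y).1 hy
    exact ⟨x, rfl⟩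
  have hfg : Function.Exact f₂ g := fun y => Iff.trans Subtype.ext_iff (hex y)
  obtain ⟨l, hl⟩ := Module.projective_lifting_property g LinearMap.id hg
  have h1 : (Function.Injective f₂ ∧ ∃ l, g ∘ₗ l = LinearMap.id) ↔
      (Function.Surjective g ∧ ∃ l, l ∘ₗ f₂ = LinearMap.id) := hfg.split_tfae'.out 0 1
  exact (h1.1 ⟨hinj, l, hl⟩).2

end Resolution

section GlobalDimension

open CategoryTheory

universe w

theorem globalDimension_le_of_ringEquiv {S S' : Type w} [Ring S] [Ring S'] (e : S ≃+* S') :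
    globalDimension S' ≤ globalDimension S := by
  refine iSup_le fun M => ?_
  let N : ModuleCat.{w} S := (ModuleCat.restrictScalars e.toRingHom).obj M
  let := RingHomInvPair.of_ringEquiv e
  let := (RingHomInvPair.of_ringEquiv e).symm
  let e' : N ≃ₛₗ[RingHomClass.toRingHom e] M :=
    { AddEquiv.refl M with map_smul' := fun _ _ => rfl }
  rw [← ModuleCat.projectiveDimension_eq_of_semiLinearEquiv e e']
  exact le_iSup (fun M : ModuleCat.{w} S => projectiveDimension M) N

theorem globalDimension_eq_of_ringEquiv {S S' : Type w} [Ring S] [Ring S'] (e : S ≃+* S') :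
    globalDimension S' = globalDimension S :=
  le_antisymm (globalDimension_le_of_ringEquiv e) (globalDimension_le_of_ringEquiv e.symm)

theorem globalDimension_eq_two {S : Type w} [Ring S]
    (hle : ∀ M : ModuleCat.{w} S, HasProjectiveDimensionLE M 2)
    {N : ModuleCat.{w} S} (hN : ¬ HasProjectiveDimensionLT N 2) : globalDimension S = 2 := by
  refine le_antisymm (iSup_le fun M => (projectiveDimension_le_iff M 2).2 (hle M)) ?_
  exact ((projectiveDimension_ge_iff N 2).2 hN).trans
    (le_iSup (fun M : ModuleCat.{w} S => projectiveDimension M) N)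

end GlobalDimension

/-! ### The difference of the shift and a coefficientwise map -/

namespace Finsupp

variable {k Y : Type*} [CommRing k] [AddCommGroup Y] [Module k Y]

/-- The map `S - φ` on finitely supported sequences, where `S` is the shift. -/
def shiftSub (φ : Y →ₗ[k] Y) : (ℕ →₀ Y) →ₗ[k] (ℕ →₀ Y) :=
  Finsupp.lmapDomain Y k Nat.succ - Finsupp.mapRange.linearMap φ

/-- With sequences read as polynomials in `T` over `Y`, `shiftSub φ` is multiplication by `T - φ`;
the leading coefficient survives it. -/
theorem shiftSub_injective (φ : Y →ₗ[k] Y) : Function.Injective (shiftSub φ) := by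
  rw [injective_iff_map_eq_zero]
  intro z hz
  by_contra hne
  have hs : z.support.Nonempty := Finsupp.support_nonempty_iff.2 hne
  have hmem := z.support.max'_mem hs
  set j := z.support.max' hs with hj
  have h1 := DFunLike.congr_fun hz (j + 1)
  have h2 : z (j + 1) = 0 := by
    by_contra h
    have := z.support.le_max' (j + 1) (Finsupp.mem_support_iff.2 h)
    omega
  have h3 : (Finsupp.mapDomain Nat.succ z) (j + 1) = z j :=
    Finsupp.mapDomain_apply Nat.succ_injective z j
  simp only [shiftSub, LinearMap.sub_apply, Finsupp.lmapDomain_apply, Finsupp.coe_sub,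
    Pi.sub_apply, Finsupp.mapRange.linearMap_apply, Finsupp.mapRange_apply, h2, map_zero, h3,
    sub_zero, Finsupp.coe_zero, Pi.zero_apply] at h1
  exact (Finsupp.mem_support_iff.1 hmem) h1

/-- Division with remainder by `T - φ`. -/
theorem exists_eq_single_add_shiftSub (φ : Y →ₗ[k] Y) (z : ℕ →₀ Y) :
    ∃ y w, z = Finsupp.single 0 y + shiftSub φ w := by
  induction z using Finsupp.induction_linear with
  | zero => exact ⟨0, 0, by simp⟩
  | add z₁ z₂ h₁ h₂ =>
    obtain ⟨y₁, w₁, h₁⟩ := h₁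
    obtain ⟨y₂, w₂, h₂⟩ := h₂
    refine ⟨y₁ + y₂, w₁ + w₂, ?_⟩
    rw [map_add, Finsupp.single_add, h₁, h₂]
    abel
  | single j y =>
    induction j generalizing y with
    | zero => exact ⟨y, 0, by simp⟩
    | succ j ih =>
      obtain ⟨y', w, h⟩ := ih (φ y)
      refine ⟨y', w + Finsupp.single j y, ?_⟩
      rw [map_add, ← add_assoc, ← h]
      simp [shiftSub]

/-- Uniqueness of the remainder: the evaluation `∑ T^j y_j ↦ ∑ φ^j y_j` kills the multiples of `T -
φ` and fixes constants. -/
theorem eq_zero_of_single_add_shiftSub_eq_zero (φ : Y →ₗ[k] Y) {y : Y} {z : ℕ →₀ Y}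
    (h : Finsupp.single 0 y + shiftSub φ z = 0) : y = 0 ∧ z = 0 := by
  let Φ : (ℕ →₀ Y) →ₗ[k] Y := Finsupp.lsum ℕ fun j => φ ^ j
  have hΦ : Φ ∘ₗ shiftSub φ = 0 := by
    refine Finsupp.lhom_ext fun j y => ?_
    rw [LinearMap.comp_apply, shiftSub, LinearMap.sub_apply, map_sub]
    simp only [Φ, Finsupp.lmapDomain_apply, Finsupp.mapDomain_single,
      Finsupp.mapRange.linearMap_apply, Finsupp.mapRange_single, Finsupp.lsum_single, pow_succ,
      Module.End.mul_apply, sub_self, LinearMap.zero_apply]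
  have h1 := congrArg Φ h
  rw [map_add, ← LinearMap.comp_apply, hΦ] at h1
  have hy : y = 0 := by simpa [Φ] using h1
  subst hy
  refine ⟨rfl, shiftSub_injective φ ?_⟩
  simpa using h

end Finsupp

/-! ### The basis of ordered monomials -/

theorem mul_pow_of_mul_eq {k R : Type*} [Field k] [Semiring R] [Algebra k R] {q : k} {u v : R}
    (h : v * u = q • (u * v) + 1) (i : ℕ) : v * u ^ i =
    q ^ i • (u ^ i * v) + (∑ j ∈ Finset.range i, q ^ j) • u ^ (i - 1) := by
  induction i with
  | zero => simp
  | succ i ih =>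
    rw [pow_succ u i, ← mul_assoc, ih, add_mul, smul_mul_assoc, mul_assoc, h, mul_add,
      mul_smul_comm, smul_add, smul_smul, mul_one, ← mul_assoc, ← pow_succ, ← pow_succ, add_assoc,
      Nat.add_sub_cancel, Finset.sum_range_succ, add_smul, add_comm (q ^ i • _), smul_mul_assoc]
    -- At exponent 0 the truncated `i - 1` is harmless, since its coefficient is an empty sum.
    rcases i with _ | i
    · simp
    · rw [Nat.add_sub_cancel, ← pow_succ]

namespace QWeyl

variable (k : Type*) [Field k] (q : k)

theorem adjoin_eq_top : Algebra.adjoin k {u k q, v k q} = ⊤ := by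
  have h : (RingQuot.mkAlgHom k (QWeylRel k q)).range = ⊤ :=
    (AlgHom.range_eq_top _).2 (RingQuot.mkAlgHom_surjective k _)
  rw [← h, ← Algebra.map_top, ← FreeAlgebra.adjoin_range_ι, AlgHom.map_adjoin]
  congr 1
  rw [← Set.range_comp]
  ext x
  simp only [Set.mem_insert_iff, Set.mem_singleton_iff, Set.mem_range, Fin.exists_fin_two,
    Function.comp_apply, u, v, eq_comm]

variable {k q} in
theorem induction {p : QWeyl k q → Prop} (hu : p (u k q)) (hv : p (v k q))
    (halg : ∀ c : k, p (algebraMap k _ c)) (hadd : ∀ x y, p x → p y → p (x + y))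
    (hmul : ∀ x y, p x → p y → p (x * y)) (x : QWeyl k q) : p x := by
  have hx : x ∈ Algebra.adjoin k {u k q, v k q} := by rw [adjoin_eq_top]; trivial
  induction hx using Algebra.adjoin_induction with
  | mem x hx =>
    obtain rfl | rfl := hx
    · exact hu
    · exact hv
  | algebraMap c => exact halg c
  | add x y _ _ hx hy => exact hadd x y hx hy
  | mul x y _ _ hx hy => exact hmul x y hx hy

section lift

variable {k q} {A : Type*} [Semiring A] [Algebra k A]

/-- The algebra map out of `k⟨u, v⟩ / (v u - q u v - 1)` given by the images of `u` and `v`. -/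
def lift (x y : A) (h : y * x = q • (x * y) + 1) : QWeyl k q →ₐ[k] A :=
  RingQuot.liftAlgHom k ⟨FreeAlgebra.lift k ![x, y], by rintro _ _ ⟨⟩; simpa using h⟩

@[simp]
theorem lift_u (x y : A) (h : y * x = q • (x * y) + 1) : lift x y h (u k q) = x := by
  simp [lift, u]

@[simp]
theorem lift_v (x y : A) (h : y * x = q • (x * y) + 1) : lift x y h (v k q) = y := by
  simp [lift, v]

end lift

/-- Left multiplication by `u` in terms of the basis of ordered monomials `u ^ i v ^ j`, where the
index is `(j, i)`. -/
def uEnd : Module.End k (ℕ × ℕ →₀ k) :=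
  Finsupp.linearCombination k fun p => Finsupp.single (p.1, p.2 + 1) 1

/-- Left multiplication by `v` in terms of the basis of ordered monomials `u ^ i v ^ j`, where the
index is `(j, i)`. -/
def vEnd : Module.End k (ℕ × ℕ →₀ k) :=
  Finsupp.linearCombination k fun p => q ^ p.2 • Finsupp.single (p.1 + 1, p.2) 1 +
    (∑ j ∈ Finset.range p.2, q ^ j) • Finsupp.single (p.1, p.2 - 1) 1

theorem vEnd_mul_uEnd : vEnd k q * uEnd k = q • (uEnd k * vEnd k q) + 1 := by
  refine Finsupp.lhom_ext' fun ⟨j, i⟩ => LinearMap.ext_ring ?_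
  simp only [uEnd, vEnd, LinearMap.comp_apply, Module.End.mul_apply, Finsupp.lsingle_apply,
    LinearMap.add_apply, LinearMap.smul_apply, Finsupp.linearCombination_single, one_smul,
    map_add, map_smul, Module.End.one_apply, Nat.add_sub_cancel, smul_add, smul_smul]
  rw [one_mul, one_mul, one_mul, one_mul, ← pow_succ', add_assoc]
  congr 1
  -- What remains is `[i+1]_q = q [i]_q + 1`; the case `i = 0` is apart because of the truncated `i
  -- - 1`.
  rcases i with _ | i
  · simp
  · rw [Nat.add_sub_cancel, Finset.sum_range_succ', Finset.mul_sum, pow_zero, add_smul, one_smul]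
    simp only [pow_succ']

/-- The representation of `k⟨u, v⟩ / (v u - q u v - 1)` on the ordered monomials. -/
def monomialRep : QWeyl k q →ₐ[k] Module.End k (ℕ × ℕ →₀ k) :=
  lift (uEnd k) (vEnd k q) (vEnd_mul_uEnd k q)

/-- The linear map sending the basis vector of index `(j, i)` to `u ^ i v ^ j`. -/
def orderedMonomials : (ℕ × ℕ →₀ k) →ₗ[k] QWeyl k q :=
  Finsupp.linearCombination k fun p => u k q ^ p.2 * v k q ^ p.1

/-- The span of the ordered monomials contains `1` and is a left ideal, because it is stable under
left multiplication by `u` and `v`. -/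
theorem orderedMonomials_surjective : Function.Surjective (orderedMonomials k q) := by
  rw [← LinearMap.range_eq_top, eq_top_iff]
  set W := LinearMap.range (orderedMonomials k q) with hW
  have hmem (j i : ℕ) : u k q ^ i * v k q ^ j ∈ W :=
    ⟨Finsupp.single (j, i) 1, by simp [orderedMonomials]⟩
  have key (r : QWeyl k q) (h : ∀ j i, r * (u k q ^ i * v k q ^ j) ∈ W) : ∀ x ∈ W, r * x ∈ W := by
    rintro _ ⟨f, rfl⟩
    induction f using Finsupp.induction_linear with
    | zero => simp
    | add f g hf hg => rw [map_add, mul_add]; exact W.add_mem hf hg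
    | single p c =>
      rw [orderedMonomials, Finsupp.linearCombination_single, mul_smul_comm]
      exact W.smul_mem _ (h p.1 p.2)
  have main (r : QWeyl k q) : ∀ x ∈ W, r * x ∈ W := by
    induction r using induction with
    | hu => exact key _ fun j i => by rw [← mul_assoc, ← pow_succ']; exact hmem _ _
    | hv =>
      refine key _ fun j i => ?_
      rw [← mul_assoc, mul_pow_of_mul_eq (v_mul_u k q), add_mul, smul_mul_assoc, mul_assoc, ← pow_succ',
        smul_mul_assoc]
      exact W.add_mem (W.smul_mem _ (hmem _ _)) (W.smul_mem _ (hmem _ _))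
    | halg c => intro x hx; rw [← Algebra.smul_def]; exact W.smul_mem _ hx
    | hadd r s hr hs => intro x hx; rw [add_mul]; exact W.add_mem (hr x hx) (hs x hx)
    | hmul r s hr hs => intro x hx; rw [mul_assoc]; exact hr _ (hs x hx)
  intro r _
  simpa using main r 1 (by simpa using hmem 0 0)

/-- Acting on the vector that stands for the monomial `1` recovers the coefficients, which gives
linear independence. -/
theorem monomialRep_orderedMonomials (f : ℕ × ℕ →₀ k) :
    monomialRep k q (orderedMonomials k q f) (Finsupp.single (0, 0) 1) = f := by
  have hv (j : ℕ) : (vEnd k q ^ j) (Finsupp.single (0, 0) 1) = Finsupp.single (j, 0) 1 := by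
    induction j with
    | zero => simp
    | succ j ih => rw [pow_succ', Module.End.mul_apply, ih]; simp [vEnd]
  have hu (j i : ℕ) : (uEnd k ^ i) (Finsupp.single (j, 0) 1) = Finsupp.single (j, i) 1 := by
    induction i with
    | zero => simp
    | succ i ih => rw [pow_succ', Module.End.mul_apply, ih]; simp [uEnd]
  induction f using Finsupp.induction_linear with
  | zero => simp
  | add f g hf hg => rw [map_add, map_add, LinearMap.add_apply, hf, hg]
  | single p c => simp [orderedMonomials, monomialRep, hv, hu]

end QWeyl

/-! ### Pairs of generators of quantum Weyl type -/

/-- The algebra `R` is a quantum Weyl algebra with generators `u` and `v`: the relation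
`v u = q u v + 1` holds and the ordered monomials `u ^ i v ^ j` form a basis. -/
structure IsQWeylPair {k R : Type*} [Field k] [Ring R] [Algebra k R] (q : k) (u v : R) : Prop where
  rel : v * u = q • (u * v) + 1
  bijective : Function.Bijective
    (Finsupp.linearCombination k fun p : ℕ × ℕ => u ^ p.2 * v ^ p.1)

theorem QWeyl.isQWeylPair (k : Type*) [Field k] (q : k) :
    IsQWeylPair q (QWeyl.u k q) (QWeyl.v k q) where
  rel := QWeyl.v_mul_u k q
  bijective := ⟨Function.LeftInverse.injective
    (g := fun r => QWeyl.monomialRep k q r (Finsupp.single (0, 0) 1))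
    (QWeyl.monomialRep_orderedMonomials k q), QWeyl.orderedMonomials_surjective k q⟩

namespace IsQWeylPair

variable {k R : Type*} [Field k] [Ring R] [Algebra k R] {q : k} {u v : R}

theorem induction (h : IsQWeylPair q u v) {p : R → Prop} (hu : p u) (hv : p v)
    (halg : ∀ c : k, p (algebraMap k R c)) (hadd : ∀ x y, p x → p y → p (x + y))
    (hmul : ∀ x y, p x → p y → p (x * y)) (x : R) : p x := by
  have hpow {r : R} (hr : p r) (n : ℕ) : p (r ^ n) := by
    induction n with
    | zero => simpa using halg 1
    | succ n ih => rw [pow_succ]; exact hmul _ _ ih hr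
  obtain ⟨f, rfl⟩ := h.bijective.2 x
  induction f using Finsupp.induction_linear with
  | zero => simpa using halg 0
  | add f g hf hg => rw [map_add]; exact hadd _ _ hf hg
  | single a c =>
    rw [Finsupp.linearCombination_single, Algebra.smul_def]
    exact hmul _ _ (halg c) (hmul _ _ (hpow hu _) (hpow hv _))

/-- The basis of ordered monomials, as an equivalence; the index of `u ^ i v ^ j` is `(j, i)`. -/
def monomialsEquiv (h : IsQWeylPair q u v) : (ℕ × ℕ →₀ k) ≃ₗ[k] R :=
  LinearEquiv.ofBijective _ h.bijective

theorem monomialsEquiv_single (h : IsQWeylPair q u v) (j i : ℕ) :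
    h.monomialsEquiv (Finsupp.single (j, i) 1) = u ^ i * v ^ j := by
  simp [monomialsEquiv]

end IsQWeylPair

/-! ### The Koszul resolution of a module over the quantum Weyl algebra -/

section Koszul

variable {k R : Type*} [Field k] [Ring R] [Algebra k R] {q : k} {u v : R}
  {N : Type*} [AddCommGroup N] [Module k N]

/-- The right multiplication by `r` tensored with the linear map `g`. -/
def mulRightTensor (r : R) (g : N →ₗ[k] N) : R ⊗[k] N →ₗ[R] R ⊗[k] N :=
  TensorProduct.AlgebraTensorModule.map (LinearMap.toSpanSingleton R R r) g

@[simp]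
theorem mulRightTensor_tmul (r : R) (g : N →ₗ[k] N) (x : R) (n : N) :
    mulRightTensor r g (x ⊗ₜ n) = (x * r) ⊗ₜ g n := rfl

section Differentials

variable [Module R N] [IsScalarTower k R N]

variable (k R N) in
/-- The augmentation `r ⊗ n ↦ r n`. -/
def koszulAug : R ⊗[k] N →ₗ[R] N :=
  TensorProduct.AlgebraTensorModule.lift
    { (Algebra.lsmul k k N : R →ₐ[k] Module.End k N).toLinearMap with
      map_smul' := fun r s => by ext n; simp }

@[simp]
theorem koszulAug_tmul (r : R) (n : N) : koszulAug k R N (r ⊗ₜ n) = r • n := rfl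

variable (k N u v) in
/-- The first differential of the Koszul resolution. -/
def koszulD₁ : (R ⊗[k] N) × (R ⊗[k] N) →ₗ[R] R ⊗[k] N :=
  (mulRightTensor u LinearMap.id - mulRightTensor 1 (Algebra.lsmul k k N u)).coprod
    (mulRightTensor v LinearMap.id - mulRightTensor 1 (Algebra.lsmul k k N v))

variable (N q u v) in
/-- The second differential of the Koszul resolution. -/
def koszulD₂ : R ⊗[k] N →ₗ[R] (R ⊗[k] N) × (R ⊗[k] N) :=
  (mulRightTensor v LinearMap.id - mulRightTensor 1 (q • Algebra.lsmul k k N v)).prod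
    (mulRightTensor 1 (Algebra.lsmul k k N u) - mulRightTensor (q • u) LinearMap.id)

theorem koszulD₂_tmul (r : R) (n : N) : koszulD₂ q u v N (r ⊗ₜ n) =
    ((r * v) ⊗ₜ n - r ⊗ₜ (q • v • n), r ⊗ₜ (u • n) - (r * (q • u)) ⊗ₜ n) := by
  simp [koszulD₂]

variable (k R N) in
theorem koszulAug_surjective : Function.Surjective (koszulAug k R N) :=
  fun n => ⟨1 ⊗ₜ n, by simp⟩

theorem koszulAug_comp_koszulD₁ : koszulAug k R N ∘ₗ koszulD₁ k u v N = 0 := by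
  ext x <;> simp [koszulD₁]

theorem koszulD₁_comp_koszulD₂ (hrel : v * u = q • (u * v) + 1) :
    koszulD₁ k u v N ∘ₗ koszulD₂ q u v N = 0 := by
  refine TensorProduct.AlgebraTensorModule.curry_injective (LinearMap.ext fun r =>
    LinearMap.ext fun n => ?_)
  have h1 : r * v * u = q • (r * u * v) + r := by
    rw [mul_assoc, hrel, mul_add, mul_one, mul_smul_comm, mul_assoc]
  have h2 : v • u • n = q • u • v • n + n := by
    rw [← mul_smul, hrel, add_smul, one_smul, smul_assoc, mul_smul]
  simp [koszulD₁, koszulD₂, h1, h2, TensorProduct.add_tmul, TensorProduct.tmul_add,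
    TensorProduct.smul_tmul', TensorProduct.tmul_smul]
  abel

end Differentials

namespace IsQWeylPair

variable (hR : IsQWeylPair q u v)

variable (N) in
/-- The tensor product of the quantum Weyl algebra with `N` in terms of the basis of
ordered monomials. -/
def tensorEquiv : (ℕ →₀ ℕ →₀ N) ≃ₗ[k] R ⊗[k] N :=
  (Finsupp.curryLinearEquiv k).symm ≪≫ₗ (TensorProduct.finsuppScalarLeft k N (ℕ × ℕ)).symm ≪≫ₗ
    TensorProduct.congr hR.monomialsEquiv (LinearEquiv.refl k N)

theorem tensorEquiv_single (j i : ℕ) (n : N) :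
    hR.tensorEquiv N (Finsupp.single j (Finsupp.single i n)) = (u ^ i * v ^ j) ⊗ₜ[k] n := by
  have h : (Finsupp.curryLinearEquiv k).symm (Finsupp.single j (Finsupp.single i n)) =
      Finsupp.single (j, i) n := by
    rw [LinearEquiv.symm_apply_eq]
    simp [Finsupp.curryLinearEquiv]
  simp only [tensorEquiv, LinearEquiv.trans_apply, h,
    TensorProduct.finsuppScalarLeft_symm_apply_single, TensorProduct.congr_tmul,
    monomialsEquiv_single, LinearEquiv.refl_apply]

/-- Right multiplication by `v` sends `u^i v^j` to `u^i v^(j+1)`, so it is the shift in the outer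
index. -/
theorem mulRightTensor_v_sub (g : N →ₗ[k] N) (z : ℕ →₀ ℕ →₀ N) :
    mulRightTensor v LinearMap.id (hR.tensorEquiv N z) -
        mulRightTensor 1 g (hR.tensorEquiv N z) =
      hR.tensorEquiv N (Finsupp.shiftSub (Finsupp.mapRange.linearMap g) z) := by
  induction z using Finsupp.induction_linear with
  | zero => simp
  | add x y hx hy => rw [map_add, map_add, map_add, map_add, map_add, ← hx, ← hy]; abel
  | single j y =>
    induction y using Finsupp.induction_linear with
    | zero => simp
    | add x y hx hy =>
      rw [Finsupp.single_add, map_add, map_add, map_add, map_add, map_add, ← hx, ← hy]; abel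
    | single i n =>
      simp [Finsupp.shiftSub, tensorEquiv_single, mul_assoc, pow_succ]

/-- Only outer index 0 is considered: on other monomials `u` would have to be moved past `v^j`. -/
theorem mulRightTensor_u_sub (g : N →ₗ[k] N) (y : ℕ →₀ N) :
    mulRightTensor u LinearMap.id (hR.tensorEquiv N (Finsupp.single 0 y)) -
        mulRightTensor 1 g (hR.tensorEquiv N (Finsupp.single 0 y)) =
      hR.tensorEquiv N (Finsupp.single 0 (Finsupp.shiftSub g y)) := by
  induction y using Finsupp.induction_linear with
  | zero => simp
  | add x y hx hy =>
    rw [map_add, Finsupp.single_add, Finsupp.single_add, map_add, map_add, map_add, map_add,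
      ← hx, ← hy]
    abel
  | single i n =>
    simp [Finsupp.shiftSub, tensorEquiv_single, pow_succ, Finsupp.single_sub]

variable [Module R N] [IsScalarTower k R N]

include hR

variable (N)

theorem koszulD₂_injective : Function.Injective (koszulD₂ q u v N) := by
  intro x y h
  obtain ⟨x, rfl⟩ := (hR.tensorEquiv N).surjective x
  obtain ⟨y, rfl⟩ := (hR.tensorEquiv N).surjective y
  have h1 := congrArg Prod.fst h
  simp only [koszulD₂, LinearMap.prod_apply, Function.prod, LinearMap.sub_apply,
    mulRightTensor_v_sub] at h1
  rw [Finsupp.shiftSub_injective _ ((hR.tensorEquiv N).injective h1)]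

/-- Modulo the image, `r ⊗ n` equals `1 ⊗ r n`. This holds for `u` and `v` by definition of the
differential, and passes to products through `r s ⊗ n - 1 ⊗ r s n = r (s ⊗ n - 1 ⊗ s n) + (r ⊗ s n -
1 ⊗ r s n)`. -/
theorem koszulD₁_exact_koszulAug : Function.Exact (koszulD₁ k u v N) (koszulAug k R N) := by
  intro x
  refine ⟨fun hx => ?_, ?_⟩
  · set W := LinearMap.range (koszulD₁ k u v N) with hW
    have key (r : R) : ∀ n : N, r ⊗ₜ[k] n - 1 ⊗ₜ[k] (r • n) ∈ W := by
      induction r using hR.induction with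
      | hu => exact fun n => ⟨(1 ⊗ₜ n, 0), by simp [koszulD₁]⟩
      | hv => exact fun n => ⟨(0, 1 ⊗ₜ n), by simp [koszulD₁]⟩
      | halg c =>
        intro n
        rw [algebraMap_smul, TensorProduct.tmul_smul, TensorProduct.smul_tmul',
          ← Algebra.algebraMap_eq_smul_one, sub_self]
        exact W.zero_mem
      | hadd r s hr hs =>
        intro n
        rw [TensorProduct.add_tmul, add_smul, TensorProduct.tmul_add, add_sub_add_comm]
        exact W.add_mem (hr n) (hs n)
      | hmul r s hr hs =>
        intro n
        have h1 := W.add_mem (W.smul_mem r (hs n)) (hr (s • n))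
        rwa [smul_sub, TensorProduct.smul_tmul', TensorProduct.smul_tmul', smul_eq_mul,
          smul_eq_mul, mul_one, sub_add_sub_cancel, ← mul_smul] at h1
    have key' : ∀ y : R ⊗[k] N, y - 1 ⊗ₜ[k] (koszulAug k R N y) ∈ W := by
      intro y
      induction y using TensorProduct.induction_on with
      | zero => simp
      | tmul r n => exact key r n
      | add y z hy hz =>
        rw [map_add, TensorProduct.tmul_add, add_sub_add_comm]
        exact W.add_mem hy hz
    have := key' x
    rwa [hx, TensorProduct.tmul_zero, sub_zero] at this
  · rintro ⟨y, rfl⟩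
    exact LinearMap.congr_fun koszulAug_comp_koszulD₁ y

/-- Division with remainder in the `v`-direction: modulo the image of `koszulD₂`, the first entry of
a cycle involves no `v`. For such a cycle the differential is a remainder plus a multiple of the
outer shift difference, so uniqueness of the remainder forces both entries to vanish. -/
theorem koszulD₂_exact_koszulD₁ : Function.Exact (koszulD₂ q u v N) (koszulD₁ k u v N) := by
  rintro ⟨x, y⟩
  refine ⟨fun h => ?_, ?_⟩
  · obtain ⟨x, rfl⟩ := (hR.tensorEquiv N).surjective x
    obtain ⟨a, w, hw⟩ := Finsupp.exists_eq_single_add_shiftSub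
      (Finsupp.mapRange.linearMap (q • Algebra.lsmul k k N v)) x
    obtain ⟨b, hb⟩ := (hR.tensorEquiv N).surjective
      (y - (koszulD₂ q u v N (hR.tensorEquiv N w)).2)
    have hfst : (koszulD₂ q u v N (hR.tensorEquiv N w)).1 = hR.tensorEquiv N
        (Finsupp.shiftSub (Finsupp.mapRange.linearMap (q • Algebra.lsmul k k N v)) w) :=
      hR.mulRightTensor_v_sub _ w
    have hsub : (hR.tensorEquiv N x, y) - koszulD₂ q u v N (hR.tensorEquiv N w) =
        (hR.tensorEquiv N (Finsupp.single 0 a), hR.tensorEquiv N b) := by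
      rw [hb]
      refine Prod.ext ?_ rfl
      rw [Prod.fst_sub, hfst, hw, map_add, add_sub_cancel_right]
    have h1 : koszulD₁ k u v N
        (hR.tensorEquiv N (Finsupp.single 0 a), hR.tensorEquiv N b) = 0 := by
      rw [← hsub, map_sub, h, zero_sub, neg_eq_zero]
      exact LinearMap.congr_fun (koszulD₁_comp_koszulD₂ hR.rel) _
    rw [koszulD₁, LinearMap.coprod_apply, LinearMap.sub_apply, LinearMap.sub_apply,
      mulRightTensor_u_sub, mulRightTensor_v_sub, ← map_add,
      LinearEquiv.map_eq_zero_iff] at h1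
    obtain ⟨h2, h3⟩ := Finsupp.eq_zero_of_single_add_shiftSub_eq_zero _ h1
    have h4 : a = 0 := Finsupp.shiftSub_injective _ (h2.trans (map_zero _).symm)
    rw [h4, h3, Finsupp.single_zero, map_zero, Prod.mk_zero_zero, sub_eq_zero] at hsub
    exact ⟨_, hsub.symm⟩
  · rintro ⟨z, hz⟩
    rw [← hz]
    exact LinearMap.congr_fun (koszulD₁_comp_koszulD₂ hR.rel) z

end IsQWeylPair

end Koszul

/-! ### Comodule algebras over group algebras -/

namespace Module.Projective

/-- A dual basis criterion: a module is projective when its identity is a sum of endomorphisms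
`x ↦ φ x • y` with `φ` a linear functional. -/
theorem of_id_mem_closure {S : Type*} {M : Type*} [Ring S] [AddCommGroup M] [Module S M]
    (h : (LinearMap.id : M →ₗ[S] M) ∈ AddSubmonoid.closure
      {e : M →ₗ[S] M | ∃ (φ : M →ₗ[S] S) (y : M), e = φ.smulRight y}) :
    Module.Projective S M := by
  have key (e : M →ₗ[S] M) (he : e ∈ AddSubmonoid.closure
      {e : M →ₗ[S] M | ∃ (φ : M →ₗ[S] S) (y : M), e = φ.smulRight y}) :
      ∃ (n : ℕ) (s : M →ₗ[S] (Fin n → S)) (t : (Fin n → S) →ₗ[S] M), t ∘ₗ s = e := by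
    induction he using AddSubmonoid.closure_induction_left with
    | zero => exact ⟨0, 0, 0, rfl⟩
    | add_left e he e' _ ih =>
      obtain ⟨φ, y, rfl⟩ := he
      obtain ⟨n, s, t, rfl⟩ := ih
      let E := Fin.consLinearEquiv S (fun _ : Fin (n + 1) => S)
      refine ⟨n + 1, E.toLinearMap ∘ₗ φ.prod s,
        ((LinearMap.toSpanSingleton S M y).coprod t) ∘ₗ E.symm.toLinearMap, ?_⟩
      ext x
      simp
  obtain ⟨n, s, t, h⟩ := key _ h
  exact Module.Projective.of_split s t h

end Module.Projective

namespace RightComoduleAlgebra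

variable {k G A : Type*} [Field k] [Group G] [Ring A] [Algebra k A]
  (C : RightComoduleAlgebra k (MonoidAlgebra k G) A)

/-- The homogeneous component of degree `g`. -/
abbrev homogeneous (g : G) : Submodule k A := C.component (MonoidAlgebra.of k G g)

variable {C}

theorem mul_mem_homogeneous {g h : G} {a b : A} (ha : a ∈ C.homogeneous g)
    (hb : b ∈ C.homogeneous h) : a * b ∈ C.homogeneous (g * h) := by
  rw [mem_component] at *
  rw [map_mul, ha, hb, Algebra.TensorProduct.tmul_mul_tmul, map_mul]

theorem pow_mem_homogeneous {g : G} {a : A} (ha : a ∈ C.homogeneous g) (n : ℕ) :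
    a ^ n ∈ C.homogeneous (g ^ n) := by
  rw [mem_component] at *
  rw [map_pow, ha, Algebra.TensorProduct.tmul_pow, map_pow]

theorem mem_coinvariants_iff_homogeneous {a : A} :
    a ∈ C.coinvariants ↔ a ∈ C.homogeneous 1 := by
  rw [mem_component, mem_coinvariants, map_one]

theorem one_mem_homogeneous : (1 : A) ∈ C.homogeneous 1 :=
  mem_coinvariants_iff_homogeneous.1 (one_mem _)

theorem homogeneous_mul_le (g h : G) :
    C.homogeneous g * C.homogeneous h ≤ C.homogeneous (g * h) :=
  Submodule.mul_le.2 fun _ ha _ hb => mul_mem_homogeneous ha hb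

variable (C)

/-- The projection to the homogeneous component of degree `g`. -/
def homogeneousProj (g : G) : A →ₗ[k] A :=
  (TensorProduct.rid k A).toLinearMap ∘ₗ
    LinearMap.lTensor A (Finsupp.lapply g ∘ₗ
      (MonoidAlgebra.coeffLinearEquiv k : MonoidAlgebra k G ≃ₗ[k] (G →₀ k)).toLinearMap) ∘ₗ
    C.ρ.toLinearMap

variable {C}

theorem homogeneousProj_of_mem {g : G} {a : A} (ha : a ∈ C.homogeneous g) :
    C.homogeneousProj g a = a := by
  rw [mem_component] at ha
  simp [homogeneousProj, ha]

theorem homogeneousProj_of_mem_of_ne {g h : G} {a : A} (ha : a ∈ C.homogeneous g) (hne : g ≠ h) :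
    C.homogeneousProj h a = 0 := by
  rw [mem_component] at ha
  simp [homogeneousProj, ha, hne]

theorem iSupIndep_homogeneous : iSupIndep C.homogeneous := by
  intro g
  rw [Submodule.disjoint_def]
  intro x hx hx'
  rw [← homogeneousProj_of_mem hx]
  have : ⨆ (h : G) (_ : h ≠ g), C.homogeneous h ≤ LinearMap.ker (C.homogeneousProj g) :=
    iSup₂_le fun h hne y hy => homogeneousProj_of_mem_of_ne hy hne
  exact this hx'

open Classical in
theorem isInternal_homogeneous (htop : ⨆ g, C.homogeneous g = ⊤) :
    DirectSum.IsInternal C.homogeneous :=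
  DirectSum.isInternal_submodule_of_iSupIndep_of_iSup_eq_top iSupIndep_homogeneous htop

section Top

variable (htop : ⨆ g, C.homogeneous g = ⊤)

include htop

theorem homogeneous_induction {p : A → Prop} (hh : ∀ g, ∀ a ∈ C.homogeneous g, p a)
    (hadd : ∀ a b, p a → p b → p (a + b)) (a : A) : p a := by
  have ha : a ∈ ⨆ g, C.homogeneous g := by rw [htop]; trivial
  induction ha using Submodule.iSup_induction' with
  | mem g x hx => exact hh g x hx
  | zero => exact hh 1 0 (Submodule.zero_mem _)
  | add x y _ _ hx hy => exact hadd x y hx hy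

theorem homogeneousProj_mem (g : G) (a : A) : C.homogeneousProj g a ∈ C.homogeneous g := by
  induction a using homogeneous_induction htop with
  | hh h a ha =>
    by_cases hgh : h = g
    · subst hgh
      rwa [homogeneousProj_of_mem ha]
    · rw [homogeneousProj_of_mem_of_ne ha hgh]
      exact Submodule.zero_mem _
  | hadd a b ha hb => rw [map_add]; exact Submodule.add_mem _ ha hb

theorem homogeneousProj_mul (g : G) {h : G} (a : A) {b : A} (hb : b ∈ C.homogeneous h) :
    C.homogeneousProj (g * h) (a * b) = C.homogeneousProj g a * b := by
  induction a using homogeneous_induction htop with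
  | hh g' a ha =>
    have hab := mul_mem_homogeneous ha hb
    by_cases hg : g' = g
    · subst hg
      rw [homogeneousProj_of_mem ha, homogeneousProj_of_mem hab]
    · rw [homogeneousProj_of_mem_of_ne ha hg, zero_mul,
        homogeneousProj_of_mem_of_ne hab fun h' => hg (mul_right_cancel h')]
  | hadd a b ha hb => rw [add_mul, map_add, ha, hb, map_add, add_mul]

theorem mul_homogeneousProj {g : G} (h : G) {a : A} (b : A) (ha : a ∈ C.homogeneous g) :
    C.homogeneousProj (g * h) (a * b) = a * C.homogeneousProj h b := by
  induction b using homogeneous_induction htop with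
  | hh h' b hb =>
    have hab := mul_mem_homogeneous ha hb
    by_cases hg : h' = h
    · subst hg
      rw [homogeneousProj_of_mem hb, homogeneousProj_of_mem hab]
    · rw [homogeneousProj_of_mem_of_ne hb hg, mul_zero,
        homogeneousProj_of_mem_of_ne hab fun h' => hg (mul_left_cancel h')]
  | hadd a b ha hb => rw [mul_add, map_add, ha, hb, map_add, mul_add]

theorem sum_homogeneousProj [Fintype G] (a : A) : ∑ g, C.homogeneousProj g a = a := by
  induction a using homogeneous_induction htop with
  | hh g a ha =>
    rw [Finset.sum_eq_single g (fun h _ hne => homogeneousProj_of_mem_of_ne ha hne.symm)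
      (fun h => absurd (Finset.mem_univ g) h), homogeneousProj_of_mem ha]
  | hadd a b ha hb => simp only [map_add, Finset.sum_add_distrib, ha, hb]

/-- The projection to the homogeneous component of degree `g`, as a map of left modules over the
coinvariants. -/
def homogeneousProjLinear (g : G) : A →ₗ[C.coinvariants] A where
  toFun := C.homogeneousProj g
  map_add' := map_add _
  map_smul' b a := by
    rw [Subalgebra.smul_def, smul_eq_mul, RingHom.id_apply, Subalgebra.smul_def, smul_eq_mul,
      ← mul_homogeneousProj htop g a (mem_coinvariants_iff_homogeneous.1 b.2), one_mul]

/-- The projection to the coinvariants, as a map of left modules. -/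
def coinvariantsProj : A →ₗ[C.coinvariants] C.coinvariants where
  toFun a := ⟨C.homogeneousProj 1 a,
    mem_coinvariants_iff_homogeneous.2 (homogeneousProj_mem htop 1 a)⟩
  map_add' a b := Subtype.ext (map_add _ a b)
  map_smul' b a := Subtype.ext ((homogeneousProjLinear htop 1).map_smul b a)

theorem coinvariantsProj_mul (a : A) (b : C.coinvariants) :
    coinvariantsProj htop (a * b) = coinvariantsProj htop a * b := by
  refine Subtype.ext ?_
  have := homogeneousProj_mul htop 1 a (mem_coinvariants_iff_homogeneous.1 b.2)
  rwa [one_mul] at this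

theorem coinvariantsProj_one : coinvariantsProj htop 1 = 1 :=
  Subtype.ext (homogeneousProj_of_mem one_mem_homogeneous)

end Top

/-! ### Consequences of `1 ∈ A_g A_{g⁻¹}`: strong grading, Galois property, projectivity -/

section StronglyGraded

/-- The property is inherited by products of degrees: insert `1 ∈ A_h A_{h⁻¹}` between the two
factors of `A_g A_{g⁻¹}`. -/
theorem one_le_homogeneous_mul_inv {τ : G} (hτ : ∀ g : G, g ∈ Subgroup.zpowers τ)
    (h1 : 1 ≤ C.homogeneous τ * C.homogeneous τ⁻¹) (h2 : 1 ≤ C.homogeneous τ⁻¹ * C.homogeneous τ)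
    (g : G) : 1 ≤ C.homogeneous g * C.homogeneous g⁻¹ := by
  have hmul (g h : G) (hg : 1 ≤ C.homogeneous g * C.homogeneous g⁻¹)
      (hh : 1 ≤ C.homogeneous h * C.homogeneous h⁻¹) :
      1 ≤ C.homogeneous (g * h) * C.homogeneous (g * h)⁻¹ :=
    calc 1 ≤ C.homogeneous g * 1 * C.homogeneous g⁻¹ := by rwa [mul_one]
      _ ≤ C.homogeneous g * (C.homogeneous h * C.homogeneous h⁻¹) * C.homogeneous g⁻¹ := by gcongr
      _ = (C.homogeneous g * C.homogeneous h) * (C.homogeneous h⁻¹ * C.homogeneous g⁻¹) := by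
        simp only [mul_assoc]
      _ ≤ C.homogeneous (g * h) * C.homogeneous (h⁻¹ * g⁻¹) := by
        gcongr <;> exact homogeneous_mul_le _ _
      _ = _ := by rw [mul_inv_rev]
  obtain ⟨n, rfl⟩ := Subgroup.mem_zpowers_iff.1 (hτ g)
  induction n with
  | zero =>
    rw [zpow_zero, inv_one, Submodule.one_le]
    simpa using Submodule.mul_mem_mul (one_mem_homogeneous (C := C)) one_mem_homogeneous
  | succ n ih => rw [zpow_add_one]; exact hmul _ _ ih h1
  | pred n ih => rw [zpow_sub_one]; exact hmul _ _ ih (by rwa [inv_inv])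

variable (hC : ∀ g : G, 1 ≤ C.homogeneous g * C.homogeneous g⁻¹)

include hC

theorem isStronglyGraded_homogeneous (htop : ⨆ g, C.homogeneous g = ⊤) :
    IsStronglyGraded C.homogeneous := by
  refine ⟨isInternal_homogeneous htop, one_mem_homogeneous, fun g h =>
    le_antisymm (homogeneous_mul_le g h) ?_⟩
  calc C.homogeneous (g * h) = 1 * C.homogeneous (g * h) := (one_mul _).symm
    _ ≤ C.homogeneous g * C.homogeneous g⁻¹ * C.homogeneous (g * h) := by gcongr; exact hC g
    _ = C.homogeneous g * (C.homogeneous g⁻¹ * C.homogeneous (g * h)) := mul_assoc _ _ _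
    _ ≤ C.homogeneous g * C.homogeneous (g⁻¹ * (g * h)) := by
      gcongr; exact homogeneous_mul_le _ _
    _ = _ := by rw [inv_mul_cancel_left]

/-- For `x ∈ A_{g⁻¹}` and `y ∈ A_g`, the class of `a x ⊗ y` maps to `a x y ⊗ g`; sum over an
expression `1 = ∑ x y`. -/
theorem isGaloisExtension_of_one_le : C.IsGaloisExtension := by
  have key (a : A) (g : G) :
      a ⊗ₜ[k] MonoidAlgebra.of k G g ∈ LinearMap.range C.galoisMap := by
    have hz (z : A) (hz : z ∈ C.homogeneous g⁻¹ * C.homogeneous g) :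
        (a * z) ⊗ₜ[k] MonoidAlgebra.of k G g ∈ LinearMap.range C.galoisMap := by
      induction hz using Submodule.mul_induction_on' with
      | mem_mul_mem x hx y hy =>
        refine ⟨Submodule.Quotient.mk ((a * x) ⊗ₜ y), ?_⟩
        rw [mem_component] at hy
        change C.preGaloisMap ((a * x) ⊗ₜ y) = _
        rw [preGaloisMap_tmul, hy, Algebra.TensorProduct.tmul_mul_tmul, one_mul, mul_assoc]
      | add x _ y _ hx hy =>
        rw [mul_add, TensorProduct.add_tmul]
        exact Submodule.add_mem _ hx hy
    have h := hC g⁻¹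
    rw [inv_inv, Submodule.one_le] at h
    simpa using hz 1 h
  rw [IsGaloisExtension, ← LinearMap.range_eq_top, eq_top_iff]
  intro x _
  induction x using TensorProduct.induction_on with
  | zero => exact Submodule.zero_mem _
  | add x y hx hy => exact Submodule.add_mem _ (hx trivial) (hy trivial)
  | tmul a f =>
    induction f using MonoidAlgebra.induction_on with
    | of g => exact key a g
    | add f f' h h' => rw [TensorProduct.tmul_add]; exact Submodule.add_mem _ (h trivial) (h' trivial)
    | smul c f h => rw [TensorProduct.tmul_smul]; exact Submodule.smul_mem _ c (h trivial)

/-- The identity is the sum of the projections `p_g`. If `1 = ∑ x y` with `x ∈ A_{g⁻¹}`, `y ∈ A_g`,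
then `p_g(a) = ∑ p_1(a x) y`, and each `a ↦ p_1(a x)` is a functional with values in the
coinvariants. -/
theorem projective_coinvariants [Finite G] (htop : ⨆ g, C.homogeneous g = ⊤) :
    Module.Projective C.coinvariants A := by
  have := Fintype.ofFinite G
  refine Module.Projective.of_id_mem_closure ?_
  set W := AddSubmonoid.closure {e : A →ₗ[C.coinvariants] A |
    ∃ (φ : A →ₗ[C.coinvariants] C.coinvariants) (y : A), e = φ.smulRight y}
  let mulR (z : A) : A →ₗ[C.coinvariants] A :=
    (LinearMap.toSpanSingleton A A z).restrictScalars C.coinvariants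
  have hz (g : G) (z : A) (hz : z ∈ C.homogeneous g⁻¹ * C.homogeneous g) :
      mulR z ∘ₗ homogeneousProjLinear htop g ∈ W := by
    induction hz using Submodule.mul_induction_on' with
    | mem_mul_mem x hx y hy =>
      refine AddSubmonoid.subset_closure ⟨coinvariantsProj htop ∘ₗ mulR x, y, ?_⟩
      ext a
      have := homogeneousProj_mul htop g a hx
      rw [mul_inv_cancel] at this
      change C.homogeneousProj g a * (x * y) = C.homogeneousProj 1 (a * x) * y
      rw [this, mul_assoc]
    | add x _ y _ hx hy =>
      convert W.add_mem hx hy using 1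
      ext a
      exact mul_add _ _ _
  have hid : (LinearMap.id : A →ₗ[C.coinvariants] A) =
      ∑ g, mulR 1 ∘ₗ homogeneousProjLinear htop g := by
    ext a
    rw [LinearMap.sum_apply]
    change a = ∑ g, C.homogeneousProj g a * 1
    simp only [mul_one, sum_homogeneousProj htop]
  rw [hid]
  refine W.sum_mem fun g _ => hz g 1 ?_
  have h := hC g⁻¹
  rwa [inv_inv, Submodule.one_le] at h

end StronglyGraded

end RightComoduleAlgebra

/-! ### Restriction to a subalgebra over which the algebra is projective -/

section Restrict

open CategoryTheory

universe w

variable {k A : Type w} [Field k] [Ring A] [Algebra k A] (B : Subalgebra k A)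

theorem Subalgebra.projective_restrictScalars [Module.Projective B A] (P : Type*) [AddCommGroup P]
    [Module A P] [Module.Projective A P] : Module.Projective B P := by
  obtain ⟨s, hs⟩ := Module.projective_def'.1 (inferInstance : Module.Projective A P)
  classical
  have : Module.Projective B (P →₀ A) := Module.Projective.of_equiv (finsuppLequivDFinsupp B).symm
  exact Module.Projective.of_split (s.restrictScalars B)
    ((Finsupp.linearCombination A (id : P → P)).restrictScalars B)
    (LinearMap.ext fun x => LinearMap.congr_fun hs x)

variable {P₂ P₁ P₀ M : Type w}
  [AddCommGroup P₂] [Module A P₂] [AddCommGroup P₁] [Module A P₁]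
  [AddCommGroup P₀] [Module A P₀] [AddCommGroup M] [Module A M]
  [Module.Projective A P₂] [Module.Projective A P₁] [Module.Projective A P₀]
  {f₂ : P₂ →ₗ[A] P₁} {f₁ : P₁ →ₗ[A] P₀} {f₀ : P₀ →ₗ[A] M}

theorem Subalgebra.hasProjectiveDimensionLE_two_of_exact [Module.Projective B A]
    (hinj : Function.Injective f₂) (hex : Function.Exact f₂ f₁)
    (hex' : Function.Exact f₁ f₀) (hsurj : Function.Surjective f₀) :
    HasProjectiveDimensionLE (ModuleCat.of B M) 2 := by
  have := B.projective_restrictScalars P₂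
  have := B.projective_restrictScalars P₁
  have := B.projective_restrictScalars P₀
  exact _root_.hasProjectiveDimensionLE_two_of_exact (f₂ := f₂.restrictScalars B)
    (f₁ := f₁.restrictScalars B) (f₀ := f₀.restrictScalars B) hinj hex hex' hsurj

omit [Module.Projective A P₂] [Module.Projective A P₁] in
-- Linearity over `B` is stated for elements of `A` acting on the `A`-modules, which suits
-- computations inside `A`.
theorem Subalgebra.exists_leftInverse_of_hasProjectiveDimensionLT_two [Module.Projective B A]
    (hinj : Function.Injective f₂) (hex : Function.Exact f₂ f₁)
    (hex' : Function.Exact f₁ f₀) (hsurj : Function.Surjective f₀)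
    (h : HasProjectiveDimensionLT (ModuleCat.of B M) 2) :
    ∃ s : P₁ →+ P₂, (∀ b ∈ B, ∀ x, s (b • x) = b • s x) ∧ ∀ x, s (f₂ x) = x := by
  have := B.projective_restrictScalars P₀
  obtain ⟨s, hs⟩ := _root_.exists_leftInverse_of_hasProjectiveDimensionLT_two
    (f₂ := f₂.restrictScalars B) (f₁ := f₁.restrictScalars B) (f₀ := f₀.restrictScalars B)
    hinj hex hex' hsurj h
  exact ⟨s.toAddMonoidHom, fun b hb x => s.map_smul ⟨b, hb⟩ x, LinearMap.congr_fun hs⟩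

end Restrict

/-! ### Coinduced modules -/

section Coinduced

/-- The module `Hom_B(A, M)` coinduced from a subalgebra `B` of `A`. -/
def Coinduced {k A : Type*} [Field k] [Ring A] [Algebra k A] (B : Subalgebra k A) (M : Type*)
    [AddCommGroup M] [Module B M] : Type _ := A →ₗ[B] M

namespace Coinduced

variable {k A : Type*} [Field k] [Ring A] [Algebra k A] (B : Subalgebra k A) (M : Type*)
    [AddCommGroup M] [Module B M]

instance : AddCommGroup (Coinduced B M) := inferInstanceAs (AddCommGroup (A →ₗ[B] M))

instance : FunLike (Coinduced B M) A M := inferInstanceAs (FunLike (A →ₗ[B] M) A M)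

instance : AddMonoidHomClass (Coinduced B M) A M :=
  inferInstanceAs (AddMonoidHomClass (A →ₗ[B] M) A M)

variable {B M}

theorem ext {f g : Coinduced B M} (h : ∀ x, f x = g x) : f = g := LinearMap.ext h

theorem map_smul (f : Coinduced B M) (b : B) (x : A) : f (b • x) = b • f x :=
  LinearMap.map_smul (show A →ₗ[B] M from f) b x

instance : Module A (Coinduced B M) where
  smul a f := LinearMap.comp (show A →ₗ[B] M from f)
    ((LinearMap.toSpanSingleton A A a).restrictScalars B)
  one_smul f := ext fun x => congrArg f (mul_one x)
  mul_smul a b f := ext fun x => congrArg f (mul_assoc x a b).symm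
  smul_zero _ := ext fun _ => rfl
  smul_add _ _ _ := ext fun _ => rfl
  add_smul a b f := ext fun x => (congrArg f (mul_add x a b)).trans (map_add f _ _)
  zero_smul f := ext fun x => (congrArg f (mul_zero x)).trans (map_zero f)

instance : Module k (Coinduced B M) := Module.compHom _ (algebraMap k A)

instance : IsScalarTower k A (Coinduced B M) where
  smul_assoc c a f := by
    rw [Algebra.smul_def, mul_smul]
    rfl

end Coinduced

end Coinduced

/-! ### The grading of the quantum Weyl algebra -/

namespace IsQWeylPair

variable {k A G : Type*} [Field k] [Ring A] [Algebra k A] [Group G] {q : k} {u v : A}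

theorem iSup_eq_top (hA : IsQWeylPair q u v) (𝒞 : G → Submodule k A) (h1 : 1 ∈ 𝒞 1)
    (hmul : ∀ g h, 𝒞 g * 𝒞 h ≤ 𝒞 (g * h)) {g h : G} (hu : u ∈ 𝒞 g) (hv : v ∈ 𝒞 h) :
    ⨆ g, 𝒞 g = ⊤ := by
  rw [eq_top_iff]
  intro x _
  have hle (g : G) : 𝒞 g ≤ ⨆ g, 𝒞 g := le_iSup 𝒞 g
  induction x using hA.induction with
  | hu => exact hle g hu
  | hv => exact hle h hv
  | halg c => rw [Algebra.algebraMap_eq_smul_one]; exact hle 1 (Submodule.smul_mem _ _ h1)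
  | hadd x y hx hy => exact Submodule.add_mem _ (hx trivial) (hy trivial)
  | hmul x y hx hy =>
    have := Submodule.mul_mem_mul (hx trivial) (hy trivial)
    rw [Submodule.iSup_mul] at this
    have hle' : ⨆ g, 𝒞 g * ⨆ h, 𝒞 h ≤ ⨆ g, 𝒞 g := iSup_le fun g => by
      rw [Submodule.mul_iSup]
      exact iSup_le fun h => (hmul g h).trans (hle _)
    exact hle' this

end IsQWeylPair

/-- Since `v^(n+1) u^(n+1) = q^(n+1) v^n u^n (u v) + [n+1]_q v^n u^n` and the first term lies in
`P`, the exponent can be lowered until it is 0. -/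
theorem one_mem_of_pow_mul_pow_mem {k A : Type*} [Field k] [Ring A] [Algebra k A] {q : k} {u v : A}
    (hrel : v * u = q • (u * v) + 1) {B P : Submodule k A} (hBP : B * P ≤ P)
    (hB : ∀ n, v ^ n * u ^ n ∈ B) (huv : u * v ∈ P) {n : ℕ} (hn : v ^ n * u ^ n ∈ P)
    (h0 : ∀ j < n, ∑ i ∈ Finset.range (j + 1), q ^ i ≠ 0) : 1 ∈ P := by
  induction n with
  | zero => simpa using hn
  | succ n ih =>
    refine ih ?_ fun j hj => h0 j (by omega)
    have h1 : v ^ (n + 1) * u ^ (n + 1) = q ^ (n + 1) • ((v ^ n * u ^ n) * (u * v)) +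
        (∑ i ∈ Finset.range (n + 1), q ^ i) • (v ^ n * u ^ n) := by
      rw [pow_succ v, mul_assoc, mul_pow_of_mul_eq hrel, mul_add, mul_smul_comm, mul_smul_comm,
        Nat.add_sub_cancel, pow_succ u, mul_assoc, mul_assoc]
    have h2 : (v ^ n * u ^ n) * (u * v) ∈ P := hBP (Submodule.mul_mem_mul (hB n) huv)
    rw [h1, Submodule.add_mem_iff_right _ (Submodule.smul_mem _ _ h2)] at hn
    exact (Submodule.smul_mem_iff _ (h0 n (by omega))).1 hn

theorem sum_pow_ne_zero {k : Type*} [Field k] {q : kˣ} {m : ℕ}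
    (hq : orderOf q = 0 ∨ m ≤ orderOf q) {j : ℕ} (hj : j + 1 < m) :
    ∑ i ∈ Finset.range (j + 1), (q : k) ^ i ≠ 0 := by
  intro h
  have h1 := geom_sum_mul (q : k) (j + 1)
  rw [h, zero_mul, eq_comm, sub_eq_zero] at h1
  have h2 : orderOf q ∣ j + 1 := orderOf_dvd_of_pow_eq_one (Units.ext (by simpa using h1))
  have h3 := Nat.le_of_dvd (Nat.succ_pos j) h2
  rcases hq with hq | hq
  · rw [hq, zero_dvd_iff] at h2
    omega
  · omega

section Coaction

open RightComoduleAlgebra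

variable {k A G : Type*} [Field k] [Ring A] [Algebra k A] [Group G] {q : kˣ} {u v : A}
  {C : RightComoduleAlgebra k (MonoidAlgebra k G) A} {τ : G} {m : ℕ}

theorem one_le_homogeneous_mul (hm : 1 ≤ m) (hτ : τ ^ m = 1)
    (hrel : v * u = (q : k) • (u * v) + 1) (hq : orderOf q = 0 ∨ m ≤ orderOf q)
    (hu : u ∈ C.homogeneous τ) (hv : v ∈ C.homogeneous τ⁻¹) :
    1 ≤ C.homogeneous τ * C.homogeneous τ⁻¹ := by
  -- As `τ^m = 1`, the powers `v^(m-1)` and `u^(m-1)` have degrees `τ` and `τ⁻¹`, so their product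
  -- is a second element of `A_τ A_{τ⁻¹}` besides `u v`.
  have hpow : τ ^ (m - 1) = τ⁻¹ := eq_inv_of_mul_eq_one_left (by rw [← pow_succ,
    Nat.sub_add_cancel hm, hτ])
  have hupow : u ^ (m - 1) ∈ C.homogeneous τ⁻¹ := hpow ▸ pow_mem_homogeneous hu _
  have hvpow : v ^ (m - 1) ∈ C.homogeneous τ := by
    have := pow_mem_homogeneous hv (m - 1)
    rwa [inv_pow, hpow, inv_inv] at this
  refine Submodule.one_le.2 (one_mem_of_pow_mul_pow_mem hrel (B := C.homogeneous 1) ?_ ?_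
    (Submodule.mul_mem_mul hu hv) (Submodule.mul_mem_mul hvpow hupow)
    fun j hj => sum_pow_ne_zero hq (by omega))
  · rw [← mul_assoc]
    gcongr
    simpa using homogeneous_mul_le (C := C) 1 τ
  · intro n
    have := mul_mem_homogeneous (pow_mem_homogeneous hv n) (pow_mem_homogeneous hu n)
    rwa [inv_pow, inv_mul_cancel] at this

theorem one_le_homogeneous_mul' (hm : 1 ≤ m) (hτ : τ ^ m = 1)
    (hrel : v * u = (q : k) • (u * v) + 1) (hq : orderOf q = 0 ∨ m ≤ orderOf q)
    (hu : u ∈ C.homogeneous τ) (hv : v ∈ C.homogeneous τ⁻¹) :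
    1 ≤ C.homogeneous τ⁻¹ * C.homogeneous τ := by
  -- The pair `(v, -q u)` satisfies the same kind of relation with parameter `q⁻¹`, so the previous
  -- lemma applies with `τ⁻¹` for `τ`.
  have hrel' : (-(q : k) • u) * v = ((q⁻¹ : kˣ) : k) • (v * (-(q : k) • u)) + 1 := by
    rw [mul_smul_comm, hrel, smul_mul_assoc, smul_smul, mul_neg, Units.inv_mul, smul_add, smul_smul]
    simp
  have := one_le_homogeneous_mul (τ := τ⁻¹) hm (by rw [inv_pow, hτ, inv_one]) hrel'
    (by rwa [orderOf_inv]) hv (by rw [inv_inv]; exact Submodule.smul_mem _ _ hu)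
  rwa [inv_inv] at this

end Coaction

/-! ### Global dimension of the coinvariants -/

section GlobalDimension

open CategoryTheory RightComoduleAlgebra

universe w

variable {k A : Type w} {G : Type*} [Field k] [Ring A] [Algebra k A] [Group G] {q : k} {u v : A}

theorem Subalgebra.hasProjectiveDimensionLE_two (hA : IsQWeylPair q u v) (B : Subalgebra k A)
    [Module.Projective B A] (N : Type w) [AddCommGroup N] [Module k N] [Module A N]
    [IsScalarTower k A N] : HasProjectiveDimensionLE (ModuleCat.of B N) 2 :=
  B.hasProjectiveDimensionLE_two_of_exact (hA.koszulD₂_injective N) (hA.koszulD₂_exact_koszulD₁ N)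
    (hA.koszulD₁_exact_koszulAug N) (koszulAug_surjective k A N)

variable {C : RightComoduleAlgebra k (MonoidAlgebra k G) A}

/-- With `π : A → B` the projection, `x ↦ (a ↦ π(a) x)` embeds `M` in `Hom_B(A, M)`, and evaluation
at `1` retracts it. Right linearity of `π` makes the embedding `B`-linear. -/
theorem RightComoduleAlgebra.coinvariants_hasProjectiveDimensionLE_two
    (hA : IsQWeylPair q u v) (htop : ⨆ g, C.homogeneous g = ⊤)
    [Module.Projective C.coinvariants A] (M : ModuleCat.{w} C.coinvariants) :
    HasProjectiveDimensionLE M 2 := by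
  let N := Coinduced C.coinvariants M
  let i : M →ₗ[C.coinvariants] N :=
    { toFun := fun x => (coinvariantsProj htop).smulRight x
      map_add' := fun x y => Coinduced.ext fun a => smul_add _ x y
      map_smul' := fun b x => Coinduced.ext fun a => by
        change coinvariantsProj htop a • b • x = coinvariantsProj htop (a * b) • x
        rw [coinvariantsProj_mul, mul_smul] }
  let r : N →ₗ[C.coinvariants] M :=
    { toFun := fun f => f 1
      map_add' := fun f g => rfl
      map_smul' := fun b f => by
        change f (1 * (b : A)) = b • f 1
        rw [← Coinduced.map_smul, Subalgebra.smul_def, smul_eq_mul, one_mul, mul_one] }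
  have hN := Subalgebra.hasProjectiveDimensionLE_two hA C.coinvariants N
  have ret : Retract M (ModuleCat.of C.coinvariants N) :=
    { i := ModuleCat.ofHom i
      r := ModuleCat.ofHom r
      retract := by
        ext x
        change coinvariantsProj htop 1 • x = x
        rw [coinvariantsProj_one, one_smul] }
  exact ret.hasProjectiveDimensionLT 3

/-- The element `1 + (q - 1) u v` is the commutator `v u - u v`, which `q`-commutes with `u`. -/
theorem pow_mul_one_add (hrel : v * u = q • (u * v) + 1) (i : ℕ) :
    (1 + (q - 1) • (u * v)) * u ^ i = q ^ i • (u ^ i * (1 + (q - 1) • (u * v))) := by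
  have h : (1 + (q - 1) • (u * v)) * u = q • (u * (1 + (q - 1) • (u * v))) := by
    rw [add_mul, one_mul, smul_mul_assoc, mul_assoc, hrel, mul_add, mul_add, mul_one,
      mul_smul_comm, mul_smul_comm, smul_add, smul_add, smul_smul, smul_smul, sub_smul _ _ u,
      one_smul, mul_comm q]
    abel
  induction i with
  | zero => simp
  | succ i ih =>
    rw [pow_succ, ← mul_assoc, ih, smul_mul_assoc, mul_assoc, h, mul_smul_comm, smul_smul,
      ← pow_succ, ← mul_assoc]

/-- A functional on a quantum Weyl algebra that is semilinear over a character `χ` of a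
subalgebra vanishes on a twisted multiple of the norm element `∑ u ^ i`. -/
theorem sum_pow_mul_eq (hrel : v * u = q • (u * v) + 1) (hq0 : q ≠ 0) (hq1 : q ≠ 1)
    {B : Subalgebra k A} {m : ℕ} (hum : u ^ m ∈ B) (huv : u * v ∈ B) {χ : A →ₐ[k] k}
    (hχu : χ u = 1) (hχv : χ v = (1 - q)⁻¹) {f : A →+ k}
    (hf : ∀ b ∈ B, ∀ x, f (b * x) = χ b * f x) :
    f ((∑ i ∈ Finset.range m, u ^ i) * v) =
      (1 - q)⁻¹ * f (∑ i ∈ Finset.range m, u ^ i) := by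
  have hq1' : 1 - q ≠ 0 := sub_ne_zero.2 hq1.symm
  have hsmul (c : k) (x : A) : f (c • x) = c * f x := by
    rw [Algebra.smul_def, hf _ (B.algebraMap_mem c), AlgHom.commutes, Algebra.algebraMap_self_apply]
  -- Apply `f` to both sides of `pow_mul_one_add`: the left side vanishes because `χ` kills `1 + (q
  -- - 1) u v ∈ B`.
  have hstep (i : ℕ) : f (u ^ (i + 1) * v) = (1 - q)⁻¹ * f (u ^ i) := by
    have h1 := congrArg f (pow_mul_one_add hrel i)
    have hχ : χ (1 + (q - 1) • (u * v)) = 0 := by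
      rw [map_add, map_smul, map_mul, map_one, hχu, hχv, one_mul, smul_eq_mul]
      field_simp
      ring
    rw [hf _ (B.add_mem B.one_mem (B.smul_mem huv _)), hχ, zero_mul, hsmul, eq_comm,
      mul_eq_zero_iff_left (pow_ne_zero i hq0), mul_add, mul_one, map_add, mul_smul_comm, hsmul,
      ← mul_assoc, ← pow_succ] at h1
    field_simp
    linear_combination -h1
  -- As `χ(u^m) = 1`, the values `f(u^i v)` at `i = 0` and `i = m` agree, so their sum over `i < m`
  -- is unchanged by `i ↦ i + 1`.
  have hzero : f (u ^ m * v) = f (u ^ 0 * v) := by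
    rw [hf _ hum, map_pow, hχu, one_pow, one_mul, pow_zero, one_mul]
  rw [Finset.sum_mul, map_sum, map_sum, Finset.mul_sum, ← Finset.sum_congr rfl fun i _ => hstep i]
  have h1 := Finset.sum_range_succ (fun i => f (u ^ i * v)) m
  rw [Finset.sum_range_succ', hzero] at h1
  exact (add_right_cancel h1).symm

/-- The characters are matched by `ω(u) = q χ(u)` and `q ω(v) = χ(v)`, so on the module of `ω` the
second differential becomes `x ↦ (x (v - χ(v)), q x (χ(u) - u))`. A splitting followed by `χ`
expresses `χ` through two functionals semilinear over `χ` on `B`, and both contributions vanish at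
`∑_{i<m} u^i`. -/
theorem not_hasProjectiveDimensionLT_two [CharZero k] (hA : IsQWeylPair q u v) (hq0 : q ≠ 0)
    (hq1 : q ≠ 1) (B : Subalgebra k A) [Module.Projective B A] {m : ℕ} (hm : m ≠ 0)
    (hum : u ^ m ∈ B) (huv : u * v ∈ B) (χ ω : A →ₐ[k] k) (hχu : χ u = 1)
    (hχv : χ v = (1 - q)⁻¹) (hωu : ω u = q) (hωv : ω v = q⁻¹ * (1 - q)⁻¹) :
    ∃ N : ModuleCat.{w} B, ¬ HasProjectiveDimensionLT N 2 := by
  let _ : Module A k := Module.compHom k (ω : A →+* k)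
  have hsmul (a : A) (c : k) : a • c = ω a * c := rfl
  have : IsScalarTower k A k := ⟨fun c a x => by
    rw [hsmul, hsmul, map_smul, smul_eq_mul, smul_eq_mul, mul_assoc]⟩
  refine ⟨ModuleCat.of B k, fun h => ?_⟩
  obtain ⟨s, hs, hsd⟩ := B.exists_leftInverse_of_hasProjectiveDimensionLT_two
    (hA.koszulD₂_injective k) (hA.koszulD₂_exact_koszulD₁ k)
    (hA.koszulD₁_exact_koszulAug k) (koszulAug_surjective k A k) h
  let e := TensorProduct.AlgebraTensorModule.rid k A A
  let F (j : A ⊗[k] k →+ (A ⊗[k] k) × (A ⊗[k] k)) : A →+ k :=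
    (χ : A →+ k).comp ((e : A ⊗[k] k →+ A).comp (s.comp (j.comp (e.symm : A →+ A ⊗[k] k))))
  let f := F (AddMonoidHom.inl _ _)
  let g := F (AddMonoidHom.inr _ _)
  have hf (b : A) (hb : b ∈ B) (x : A) : f (b * x) = χ b * f x := by
    change χ (e (s (e.symm (b • x), 0))) = χ b * χ (e (s (e.symm x, 0)))
    rw [e.symm.map_smul, ← smul_zero b, ← Prod.smul_mk, hs b hb, e.map_smul, smul_zero,
      smul_eq_mul, map_mul]
  have hg (b : A) (hb : b ∈ B) (x : A) : g (b * x) = χ b * g x := by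
    change χ (e (s (0, e.symm (b • x)))) = χ b * χ (e (s (0, e.symm x)))
    rw [e.symm.map_smul, ← smul_zero b, ← Prod.smul_mk, hs b hb, e.map_smul, smul_zero,
      smul_eq_mul, map_mul]
  have key (x : A) : χ x = f (x * v - (1 - q)⁻¹ • x) + g (q • (x - x * u)) := by
    change _ = χ (e (s (_, 0))) + χ (e (s (0, _)))
    rw [← map_add, ← map_add, ← map_add, Prod.mk_add_mk, zero_add, add_zero]
    have h1 : (e.symm (x * v - (1 - q)⁻¹ • x), e.symm (q • (x - x * u))) =
        koszulD₂ q u v k (x ⊗ₜ 1) := by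
      rw [koszulD₂_tmul]
      refine Prod.ext (e.injective ?_) (e.injective ?_)
      · rw [LinearEquiv.apply_symm_apply, map_sub, hsmul, hωv]
        simp only [e, TensorProduct.AlgebraTensorModule.rid_tmul, one_smul, mul_one, smul_eq_mul,
          mul_inv_cancel_left₀ hq0]
      · rw [LinearEquiv.apply_symm_apply, map_sub, hsmul, hωu]
        simp only [e, TensorProduct.AlgebraTensorModule.rid_tmul, one_smul, mul_one,
          mul_smul_comm, smul_sub]
    refine Eq.trans ?_ (congrArg (fun z => χ (e (s z))) h1).symm
    simp only [hsd, e, TensorProduct.AlgebraTensorModule.rid_tmul, one_smul]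
  have h1 := key (∑ i ∈ Finset.range m, u ^ i)
  have hfs : f ((1 - q)⁻¹ • ∑ i ∈ Finset.range m, u ^ i) =
      (1 - q)⁻¹ * f (∑ i ∈ Finset.range m, u ^ i) := by
    rw [Algebra.smul_def, hf _ (B.algebraMap_mem _), AlgHom.commutes, Algebra.algebraMap_self_apply]
  -- The sum telescopes: `(∑ u^i)(1 - u) = 1 - u^m` lies in `B` and is killed by `χ`.
  have hgs : g (q • ((∑ i ∈ Finset.range m, u ^ i) -
      (∑ i ∈ Finset.range m, u ^ i) * u)) = 0 := by
    have h2 := hg (q • (1 - u ^ m)) (B.smul_mem (B.sub_mem B.one_mem hum) _) 1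
    rwa [map_smul, map_sub, map_one, map_pow, hχu, one_pow, sub_self, smul_zero, zero_mul,
      mul_one, ← geom_sum_mul_neg, mul_sub, mul_one] at h2
  rw [map_sub, sum_pow_mul_eq hA.rel hq0 hq1 hum huv hχu hχv hf, hfs, sub_self, hgs, add_zero] at h1
  -- Here `χ(∑_{i<m} u^i) = m`, nonzero in characteristic zero.
  simp [hχu, hm] at h1

end GlobalDimension

/-! ### The anti-automorphism exchanging the generators -/

namespace QWeyl

open MulOpposite

variable (k : Type*) [Field k] (q : k)

/-- The algebra map to the opposite algebra exchanging `u` and `v`. -/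
def swapHom : QWeyl k q →ₐ[k] (QWeyl k q)ᵐᵒᵖ :=
  lift (op (v k q)) (op (u k q)) (by rw [← op_mul, ← op_mul, v_mul_u]; rfl)

variable {k q}

theorem unop_swapHom_unop_swapHom (x : QWeyl k q) :
    unop (swapHom k q (unop (swapHom k q x))) = x := by
  have h : (AlgHom.opComm (swapHom k q)).comp (swapHom k q) = AlgHom.id k (QWeyl k q) := by
    apply hom_ext <;> simp [swapHom, AlgHom.opComm]
  exact DFunLike.congr_fun h x

end QWeyl

namespace RightComoduleAlgebra

open MulOpposite

variable {k A G : Type*} [Field k] [Ring A] [Algebra k A] [Group G] {q : k} {u v : A}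
  {C : RightComoduleAlgebra k (MonoidAlgebra k G) A} {τ : G}

/-- The elements of degree `g` whose image has degree `g⁻¹` form a multiplicative family containing
`u` and `v`, so they span `A`. Projecting to degree `g` then shows that every element of degree `g`
is of this kind. -/
theorem unop_mem_homogeneous_inv (hA : IsQWeylPair q u v) (hu : u ∈ C.homogeneous τ)
    (hv : v ∈ C.homogeneous τ⁻¹) (θ : A →ₐ[k] Aᵐᵒᵖ) (hθu : θ u = op v) (hθv : θ v = op u) {g : G}
    {x : A} (hx : x ∈ C.homogeneous g) : unop (θ x) ∈ C.homogeneous g⁻¹ := by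
  let 𝒞 (g : G) : Submodule k A := C.homogeneous g ⊓ (C.homogeneous g⁻¹).comap
    ((opLinearEquiv k).symm.toLinearMap ∘ₗ θ.toLinearMap)
  have hmem {g : G} {x : A} : x ∈ 𝒞 g ↔ x ∈ C.homogeneous g ∧ unop (θ x) ∈ C.homogeneous g⁻¹ :=
    Iff.rfl
  have htop : ⨆ g, 𝒞 g = ⊤ := by
    refine hA.iSup_eq_top (g := τ) (h := τ⁻¹) 𝒞 ?_ ?_ ?_ ?_
    · rw [hmem, map_one, unop_one, inv_one]
      exact ⟨one_mem_homogeneous, one_mem_homogeneous⟩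
    · refine fun g h => Submodule.mul_le.2 fun x hx y hy => ?_
      rw [hmem] at *
      rw [map_mul, unop_mul, mul_inv_rev]
      exact ⟨mul_mem_homogeneous hx.1 hy.1, mul_mem_homogeneous hy.2 hx.2⟩
    · rw [hmem, hθu, unop_op]
      exact ⟨hu, hv⟩
    · rw [hmem, hθv, unop_op, inv_inv]
      exact ⟨hv, hu⟩
  have hproj (y : A) : C.homogeneousProj g y ∈ 𝒞 g := by
    have hy : y ∈ ⨆ g, 𝒞 g := by rw [htop]; trivial
    induction hy using Submodule.iSup_induction' with
    | mem h y hy =>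
      by_cases hg : h = g
      · subst hg
        rwa [homogeneousProj_of_mem (hmem.1 hy).1]
      · rw [homogeneousProj_of_mem_of_ne (hmem.1 hy).1 hg]
        exact Submodule.zero_mem _
    | zero => rw [map_zero]; exact Submodule.zero_mem _
    | add y z _ _ hy hz => rw [map_add]; exact Submodule.add_mem _ hy hz
  have := hproj x
  rw [homogeneousProj_of_mem hx] at this
  exact this.2

/-- The coinvariants are isomorphic to their opposite, through an involutive anti-automorphism
preserving them. -/
def coinvariantsOpEquiv (θ : A →ₐ[k] Aᵐᵒᵖ) (hθ : ∀ x, unop (θ (unop (θ x))) = x)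
    (hmem : ∀ x ∈ C.coinvariants, unop (θ x) ∈ C.coinvariants) :
    C.coinvariants ≃+* C.coinvariantsᵐᵒᵖ where
  toFun x := op ⟨unop (θ x), hmem x x.2⟩
  invFun y := ⟨unop (θ (unop y : C.coinvariants)), hmem _ (unop y).2⟩
  left_inv x := Subtype.ext (hθ x)
  right_inv y := unop_injective (Subtype.ext (hθ (unop y : C.coinvariants)))
  map_mul' x y := unop_injective (Subtype.ext (by simp))
  map_add' x y := unop_injective (Subtype.ext (by simp))

end RightComoduleAlgebra

end

theorem lemma6p7 {k : Type*} [Field k] [IsAlgClosed k] [CharZero k]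
    (m : ℕ) (hm : 1 ≤ m) {G : Type*} [Group G] (hG : Nat.card G = m)
    (τ : G) (hτ : ∀ g : G, g ∈ Subgroup.zpowers τ)
    -- `orderOf q = 0` means that `q` has infinite order
    (q : kˣ) (hq1 : q ≠ 1) (hq : orderOf q = 0 ∨ m ≤ orderOf q) :
    IsStronglyGraded
        (fun g : G => (QWeyl.coaction k (q : k) τ).component (MonoidAlgebra.of k G g)) ∧
      (QWeyl.coaction k (q : k) τ).IsGaloisExtension ∧
      globalDimension (QWeyl.coaction k (q : k) τ).coinvariants = 2 ∧
      globalDimension ((QWeyl.coaction k (q : k) τ).coinvariants)ᵐᵒᵖ = 2 := by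
  set C := QWeyl.coaction k (q : k) τ with hC
  have : Finite G := Nat.finite_of_card_ne_zero (by omega)
  have hA := QWeyl.isQWeylPair k (q : k)
  have hu : QWeyl.u k (q : k) ∈ C.homogeneous τ := QWeyl.coactionHom_u k (q : k) τ
  have hv : QWeyl.v k (q : k) ∈ C.homogeneous τ⁻¹ := QWeyl.coactionHom_v k (q : k) τ
  have htop : ⨆ g, C.homogeneous g = ⊤ := hA.iSup_eq_top _
    RightComoduleAlgebra.one_mem_homogeneous RightComoduleAlgebra.homogeneous_mul_le hu hv
  have hτm : τ ^ m = 1 := hG ▸ pow_card_eq_one'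
  have hone := RightComoduleAlgebra.one_le_homogeneous_mul_inv hτ
    (one_le_homogeneous_mul hm hτm hA.rel hq hu hv) (one_le_homogeneous_mul' hm hτm hA.rel hq hu hv)
  have hproj := RightComoduleAlgebra.projective_coinvariants hone htop
  have hq0 : (q : k) ≠ 0 := q.ne_zero
  have hq1' : (q : k) ≠ 1 := fun h => hq1 (Units.ext h)
  have hq1'' : 1 - (q : k) ≠ 0 := sub_ne_zero.2 hq1'.symm
  -- A character is a pair of scalars `(a, b)` with `(1 - q) a b = 1`; here `a = 1`, and `a = q` for
  -- `ω`.
  let χ : QWeyl k (q : k) →ₐ[k] k := QWeyl.lift 1 (1 - (q : k))⁻¹ (by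
    rw [smul_eq_mul]
    field_simp
    ring)
  let ω : QWeyl k (q : k) →ₐ[k] k := QWeyl.lift (q : k) ((q : k)⁻¹ * (1 - (q : k))⁻¹) (by
    rw [smul_eq_mul]
    field_simp
    ring)
  have hum : QWeyl.u k (q : k) ^ m ∈ C.coinvariants := by
    rw [RightComoduleAlgebra.mem_coinvariants_iff_homogeneous, ← hτm]
    exact RightComoduleAlgebra.pow_mem_homogeneous hu m
  have huv : QWeyl.u k (q : k) * QWeyl.v k (q : k) ∈ C.coinvariants := by
    rw [RightComoduleAlgebra.mem_coinvariants_iff_homogeneous, ← mul_inv_cancel τ]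
    exact RightComoduleAlgebra.mul_mem_homogeneous hu hv
  obtain ⟨N, hN⟩ := not_hasProjectiveDimensionLT_two hA hq0 hq1' C.coinvariants (by omega) hum huv
    χ ω (QWeyl.lift_u _ _ _) (QWeyl.lift_v _ _ _) (QWeyl.lift_u _ _ _) (QWeyl.lift_v _ _ _)
  have hdim : globalDimension C.coinvariants = 2 := globalDimension_eq_two
    (RightComoduleAlgebra.coinvariants_hasProjectiveDimensionLE_two hA htop) hN
  have hmem (x) (hx : x ∈ C.coinvariants) :
      MulOpposite.unop (QWeyl.swapHom k (q : k) x) ∈ C.coinvariants := by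
    rw [RightComoduleAlgebra.mem_coinvariants_iff_homogeneous] at *
    have := RightComoduleAlgebra.unop_mem_homogeneous_inv hA hu hv (QWeyl.swapHom k (q : k))
      (QWeyl.lift_u _ _ _) (QWeyl.lift_v _ _ _) hx
    rwa [inv_one] at this
  refine ⟨RightComoduleAlgebra.isStronglyGraded_homogeneous hone htop,
    RightComoduleAlgebra.isGaloisExtension_of_one_le hone, hdim, ?_⟩
  rw [← hdim]
  exact globalDimension_eq_of_ringEquiv (RightComoduleAlgebra.coinvariantsOpEquiv
    (QWeyl.swapHom k (q : k)) QWeyl.unop_swapHom_unop_swapHom hmem)
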